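/- Let $\mathcal E$ be a completely positive trace-preserving linear map on $M_d(\mathbb C)$, $d\ge 1$, and let $|\psi^+\rangle = d^{-1/2}\sum_i |i\rangle\otimes|i\rangle$. For a Kraus representation $\mathcal E(\rho)=\sum_i M_i\rho M_i^\dagger$ put $p_i=\|(M_i\otimes 1)\psi^+\|^2$ and $\psi_i=p_i^{-1/2}(M_i\otimes 1)\psi^+$ (with $\psi_i=0$ if $p_i=0$). The representation is called diagonal if $\mathrm{tr}(M_\mu^\dagger M_\nu)=0$ for $\mu\ne\nu$. Let $W=(\mathcal E\otimes\mathrm{id})(|\psi^+\rangle\langle\psi^+|)$ be the Choi state, and let $S_{\mathcal E}=-\sum_\lambda\lambda\log_2\lambda$, the sum being over the eigenvalues of $W$ with multiplicity ($0\log_2 0=0$). A storage code for $n$ uses with $m$ qubits is a pair consisting of a completely positive trace-preserving map from the operators on $n$ pairs of $d$-level systems to those on $(\mathbb C^2)^{\otimes m}$ (the encoding) and one in the opposite direction (the decoding). It is $\varepsilon$-faithful for $\mathcal E$ if, for all choices of (finite) Kraus representations $(M^{(t)}_i)_i$ of $\mathcal E$, $t=1,\dots,n$, one for each use, the following average fidelity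 is at least $1-\varepsilon$: for a sequence $x=(x_1,\dots,x_n)$ of outcomes put $p_x=\prod_t p^{(t)}_{x_t}$ and $\psi_x=\bigotimes_t\psi^{(t)}_{x_t}$; encode and decode $|\psi_x\rangle\langle\psi_x|$ to obtain a state $\sigma_x$; the average fidelity is $\sum_x p_x\langle\psi_x|\sigma_x|\psi_x\rangle$. (The code does not depend on the Kraus representations.) A rate $R\in\mathbb R$ is achievable if for every $\varepsilon>0$ and all sufficiently large $n$ there is an $\varepsilon$-faithful code for $n$ uses with $m\le nR$ qubits. Then: 1. $\mathcal E$ has a diagonal Kraus representation. 2. For every diagonal Kraus representation $(M_\mu)$ of $\mathcal E$: $\sum_\mu p_\mu=1$, the $\psi_\mu$ are pairwise orthogonal, $W=\sum_\mu p_\mu|\psi_\mu\rangle\langle\psi_\mu|$, the nonzero $p_\mu$ are the nonzero eigenvalues of $W$ with multiplicity, and $S_{\mathcal E}=-\sum_\mu p_\mu\log_2 p_\mu$. 3. $S_{\mathcal E}$ is the optimal asymptotic rate, in qubits per use, at which the Kraus sequences of $\mathcal E$ can be faithfully stored: it is the infimum of the achievable rates. 4. The converse holds already for a diagonal ensemble: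 if $(M_\mu)$ is a diagonal Kraus representation of $\mathcal E$ and $R<S_{\mathcal E}$, there is $\varepsilon>0$ such that for all sufficiently large $n$, all $m\le nR$, all assignments of $m$-qubit density matrices $\tau_x$ to the sequences $x=(\mu_1,\dots,\mu_n)$, and all completely positive trace-preserving decodings $D$, with $p_x=\prod_t p_{\mu_t}$ and $\psi_x=\bigotimes_t\psi_{\mu_t}$, one has $\sum_x p_x\langle\psi_x|D(\tau_x)|\psi_x\rangle\le 1-\varepsilon$. -/

import Mathlib

open Matrix Filter
open scoped Kronecker ComplexOrder

/-- The ampliation `Φ ⊗ id` of a linear map `Φ` between matrix algebras, acting on the first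
tensor factor. -/
def ampliation {a b k : Type*} (Φ : Matrix a a ℂ →ₗ[ℂ] Matrix b b ℂ)
    (X : Matrix (a × k) (a × k) ℂ) : Matrix (b × k) (b × k) ℂ :=
  Matrix.of fun p q => Φ (Matrix.of fun i j => X (i, p.2) (j, q.2)) p.1 q.1

/-- Completely positive and trace preserving maps between matrix algebras: every ampliation
`Φ ⊗ id_k` maps positive semidefinite matrices to positive semidefinite matrices, and
`tr Φ(X) = tr X`. -/
structure IsCPTP {a b : Type*} [Fintype a] [Fintype b]
    (Φ : Matrix a a ℂ →ₗ[ℂ] Matrix b b ℂ) : Prop where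
  completely_positive : ∀ (k : ℕ) (X : Matrix (a × Fin k) (a × Fin k) ℂ),
    X.PosSemidef → (ampliation Φ X).PosSemidef
  trace_preserving : ∀ X : Matrix a a ℂ, (Φ X).trace = X.trace

/-- Density matrices. -/
structure IsDensity {a : Type*} [Fintype a] (ρ : Matrix a a ℂ) : Prop where
  posSemidef : ρ.PosSemidef
  trace_eq_one : ρ.trace = 1

section OneUse

variable {d : Type*} [Fintype d] [DecidableEq d]

/-- `(M i)` is a Kraus representation of `E`: `E ρ = ∑ i, M i ρ (M i)†`. -/
def IsKraus {ι : Type*} [Fintype ι] (E : Matrix d d ℂ →ₗ[ℂ] Matrix d d ℂ)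
    (M : ι → Matrix d d ℂ) : Prop :=
  ∀ ρ : Matrix d d ℂ, E ρ = ∑ i, M i * ρ * (M i)ᴴ

/-- A diagonal Kraus representation: the Kraus operators are pairwise orthogonal in the trace
inner product. -/
structure IsDiagonalKraus {ι : Type*} [Fintype ι] (E : Matrix d d ℂ →ₗ[ℂ] Matrix d d ℂ)
    (M : ι → Matrix d d ℂ) : Prop where
  isKraus : IsKraus E M
  trace_orthogonal : ∀ i j, i ≠ j → ((M i)ᴴ * M j).trace = 0

/-- The maximally entangled state vector `ψ⁺ = |d|^(-1/2) ∑ i, |i⟩ ⊗ |i⟩`. -/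
noncomputable def maxEntangled (d : Type*) [Fintype d] [DecidableEq d] : d × d → ℂ :=
  fun p => if p.1 = p.2 then ((√(Fintype.card d : ℝ))⁻¹ : ℝ) else 0

/-- The Choi state: `E` acts on the first half of `ψ⁺`. -/
noncomputable def choiState (E : Matrix d d ℂ →ₗ[ℂ] Matrix d d ℂ) : Matrix (d × d) (d × d) ℂ :=
  ampliation E (vecMulVec (maxEntangled d) (star (maxEntangled d)))

/-- The entropy (in bits) of the map `E`: `-∑ p log₂ p` over the spectrum of the Choi state,
counted with multiplicity. -/
noncomputable def mapEntropy (E : Matrix d d ℂ →ₗ[ℂ] Matrix d d ℂ) : ℝ :=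
  -((choiState E).charpoly.roots.map fun z : ℂ => z.re * Real.logb 2 z.re).sum

/-- The unnormalized vector `(M ⊗ 1) ψ⁺`. -/
noncomputable def krausVec (M : Matrix d d ℂ) : d × d → ℂ :=
  (M ⊗ₖ (1 : Matrix d d ℂ)) *ᵥ maxEntangled d

/-- The probability `‖(M ⊗ 1) ψ⁺‖²` of the Kraus operator `M` acting on half of `ψ⁺`. -/
noncomputable def krausWeight (M : Matrix d d ℂ) : ℝ :=
  ∑ p, ‖krausVec M p‖ ^ 2

/-- The normalized vector `(M ⊗ 1) ψ⁺ / ‖(M ⊗ 1) ψ⁺‖` (and `0` if `M = 0`). -/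
noncomputable def krausState (M : Matrix d d ℂ) : d × d → ℂ :=
  ((√(krausWeight M))⁻¹ : ℝ) • krausVec M

end OneUse

/-- The fidelity `⟨v| ρ |v⟩` of a state `ρ` with a pure state `v`. -/
noncomputable def pureFidelity {a : Type*} [Fintype a] (v : a → ℂ) (ρ : Matrix a a ℂ) : ℝ :=
  (star v ⬝ᵥ (ρ *ᵥ v)).re

section ManyUses

variable {d : Type*} [Fintype d] [DecidableEq d]

/-- The operator `M 0 ⊗ ⋯ ⊗ M (n-1)` on `n` copies of the system, whose basis is indexed by
`Fin n → d`.  Since `ψ⁺` for the index type `Fin n → d` is the `n`-fold tensor power of `ψ⁺` for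
`d` (with the tensor factors regrouped), `krausState (tensorOp M)` is the tensor product of the
`krausState (M t)`. -/
def tensorOp {n : ℕ} (M : Fin n → Matrix d d ℂ) : Matrix (Fin n → d) (Fin n → d) ℂ :=
  Matrix.of fun i j => ∏ t, M t (i t) (j t)

/-- A (blind) storage code for `n` uses with a memory of `m` qubits: a quantum operation from the
`n` halves-acted-on maximally entangled pairs to the memory, and a quantum operation back. It sees
only the state, not the Kraus representation used by the source or the source's outcomes. -/
structure StorageCode (d : Type*) [Fintype d] [DecidableEq d] (n m : ℕ) where
  encode : Matrix ((Fin n → d) × (Fin n → d)) ((Fin n → d) × (Fin n → d)) ℂ →ₗ[ℂ]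
    Matrix (Fin (2 ^ m)) (Fin (2 ^ m)) ℂ
  decode : Matrix (Fin (2 ^ m)) (Fin (2 ^ m)) ℂ →ₗ[ℂ]
    Matrix ((Fin n → d) × (Fin n → d)) ((Fin n → d) × (Fin n → d)) ℂ
  encode_cptp : IsCPTP encode
  decode_cptp : IsCPTP decode

/-- The average fidelity in the following test.  The source implements the `t`-th use of the map
with the Kraus operators `M t`, on half of `ψ⁺`, and reads out the outcome `x t`; this produces
`⨂ₜ (M t (x t) ⊗ 1) ψ⁺`, which is encoded and decoded; the source announces `x`, and the
decoded state is tested against the state that the announced Kraus sequence produced. -/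
noncomputable def StorageCode.averageFidelity {n m r : ℕ} (C : StorageCode d n m)
    (M : Fin n → Fin r → Matrix d d ℂ) : ℝ :=
  ∑ x : Fin n → Fin r,
    krausWeight (tensorOp fun t => M t (x t)) *
      pureFidelity (krausState (tensorOp fun t => M t (x t)))
        (C.decode (C.encode (vecMulVec (krausState (tensorOp fun t => M t (x t)))
          (star (krausState (tensorOp fun t => M t (x t)))))))

/-- The code stores the Kraus sequences of `n` uses of `E` with error at most `ε`, whatever Kraus
representations of `E` the source chooses (possibly a different one at each use). -/
def StorageCode.IsFaithful {n m : ℕ} (C : StorageCode d n m)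
    (E : Matrix d d ℂ →ₗ[ℂ] Matrix d d ℂ) (ε : ℝ) : Prop :=
  ∀ (r : ℕ) (M : Fin n → Fin r → Matrix d d ℂ), (∀ t, IsKraus E (M t)) →
    1 - ε ≤ C.averageFidelity M

/-- `R` qubits per use suffice asymptotically: for every error `ε > 0` and all large `n` there is
an `ε`-faithful code for `n` uses with at most `n R` qubits of memory. -/
def IsAchievableRate (E : Matrix d d ℂ →ₗ[ℂ] Matrix d d ℂ) (R : ℝ) : Prop :=
  ∀ ε : ℝ, 0 < ε → ∀ᶠ n : ℕ in atTop, ∃ m : ℕ, (m : ℝ) ≤ n * R ∧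
    ∃ C : StorageCode d n m, C.IsFaithful E ε

end ManyUses

/-! Up to the factor 1/d, `krausVec` carries the trace inner product to the inner product of
vectors, and for every Kraus representation the rank-one operators of its vectors add up to the Choi
state W. A diagonal representation is therefore an orthogonal eigendecomposition of W. One is
obtained from the spectral theorem, and comparing VV† with V†V, where V has the vectors as columns,
identifies the nonzero weights with the nonzero spectrum.

Achievability is Schumacher compression. Let S be the entropy and P the projection onto the n-fold
products of eigenvectors of weight at least 2^(-n(S+δ)). Its rank is at most 2^(n(S+δ)), and by
Chebyshev (`eventually_sum_le_of_entropy_deviation`) it captures almost all the weight. The mean of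
⟨ψ|P|ψ⟩ depends only on the average state, hence is the same for all Kraus representations; so one
code serves them all (`exists_isFaithful`).

For the converse, each memory state is bounded by the identity, so the fidelities with orthogonal
target states are dominated by numbers whose sum is at most the memory dimension 2^m
(`sum_krausWeight_mul_pureFidelity_le`). If m ≤ nR with R < S, the sequences light enough for this
bound to be small carry almost all the weight. -/

/-! ### Product distributions and asymptotic equipartition. -/

section TypicalSequences

variable {ι : Type*} [Fintype ι]

theorem sum_fin_succ_pi {α : Type*} [AddCommMonoid α] {n : ℕ} (g : (Fin (n + 1) → ι) → α) :
    ∑ x, g x = ∑ i, ∑ y : Fin n → ι, g (Fin.cons i y) := by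
  rw [← (Fin.consEquiv fun _ => ι).sum_comp, Fintype.sum_prod_type]
  rfl

theorem sum_prod_pi {α : Type*} [CommSemiring α] (n : ℕ) (p : Fin n → ι → α) :
    ∑ x : Fin n → ι, ∏ t, p t (x t) = ∏ t, ∑ i, p t i :=
  (Fintype.prod_sum p).symm

theorem sum_prod_pi_eq_one {p : ι → ℝ} (hp : ∑ i, p i = 1) (n : ℕ) :
    ∑ x : Fin n → ι, ∏ t, p (x t) = 1 := by
  rw [sum_prod_pi n fun _ => p]
  simp [hp]

/-- The sum of `n` independent copies of a centred variable is centred. -/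
theorem sum_prod_mul_sum_eq_zero {p f : ι → ℝ} (hp : ∑ i, p i = 1) (hf : ∑ i, p i * f i = 0)
    (n : ℕ) : ∑ x : Fin n → ι, (∏ t, p (x t)) * ∑ t, f (x t) = 0 := by
  induction n with
  | zero => simp
  | succ n ih =>
    rw [sum_fin_succ_pi]
    have h : ∀ i, ∑ y : Fin n → ι, (∏ t, p ((Fin.cons i y : Fin (n + 1) → ι) t)) *
        ∑ t, f ((Fin.cons i y : Fin (n + 1) → ι) t) = p i * f i := by
      intro i
      simp only [Fin.prod_univ_succ, Fin.sum_univ_succ, Fin.cons_zero, Fin.cons_succ]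
      calc _ = p i * f i * (∑ y : Fin n → ι, ∏ t, p (y t)) +
            p i * ∑ y : Fin n → ι, (∏ t, p (y t)) * ∑ t, f (y t) := by
            simp only [Finset.mul_sum (s := Finset.univ (α := Fin n → ι)),
              ← Finset.sum_add_distrib]
            exact Finset.sum_congr rfl fun y _ => by ring
        _ = _ := by rw [ih, sum_prod_pi_eq_one hp]; ring
    simp only [h, hf]

/-- The variance of a sum of `n` independent copies of a centred variable. -/
theorem sum_prod_mul_sum_sq {p f : ι → ℝ} (hp : ∑ i, p i = 1) (hf : ∑ i, p i * f i = 0)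
    (n : ℕ) : ∑ x : Fin n → ι, (∏ t, p (x t)) * (∑ t, f (x t)) ^ 2 =
      n * ∑ i, p i * f i ^ 2 := by
  induction n with
  | zero => simp
  | succ n ih =>
    rw [sum_fin_succ_pi]
    have h : ∀ i, ∑ y : Fin n → ι, (∏ t, p ((Fin.cons i y : Fin (n + 1) → ι) t)) *
        (∑ t, f ((Fin.cons i y : Fin (n + 1) → ι) t)) ^ 2 =
          p i * f i ^ 2 + p i * (n * ∑ i, p i * f i ^ 2) := by
      intro i
      simp only [Fin.prod_univ_succ, Fin.sum_univ_succ, Fin.cons_zero, Fin.cons_succ]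
      calc _ = p i * f i ^ 2 * (∑ y : Fin n → ι, ∏ t, p (y t)) +
            2 * p i * f i * (∑ y : Fin n → ι, (∏ t, p (y t)) * ∑ t, f (y t)) +
            p i * ∑ y : Fin n → ι, (∏ t, p (y t)) * (∑ t, f (y t)) ^ 2 := by
            simp only [Finset.mul_sum (s := Finset.univ (α := Fin n → ι)),
              ← Finset.sum_add_distrib]
            exact Finset.sum_congr rfl fun y _ => by ring
        _ = _ := by rw [ih, sum_prod_pi_eq_one hp, sum_prod_mul_sum_eq_zero hp hf]; ring
    simp only [h, Finset.sum_add_distrib, ← Finset.sum_mul, hp]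
    push_cast
    ring

/-- The Chebyshev inequality for the empirical entropy of sequences. -/
theorem sum_le_of_entropy_deviation {p : ι → ℝ} (hp0 : ∀ i, 0 ≤ p i) (hp : ∑ i, p i = 1)
    {S : ℝ} (hS : S = -∑ i, p i * Real.logb 2 (p i))
    {δ : ℝ} (hδ : 0 < δ) {n : ℕ} (hn : 0 < n) (s : Finset (Fin n → ι))
    (hs : ∀ x ∈ s, 0 < ∏ t, p (x t) →
      n * δ ≤ |-Real.logb 2 (∏ t, p (x t)) - n * S|) :
    ∑ x ∈ s, ∏ t, p (x t) ≤
      (∑ i, p i * (-Real.logb 2 (p i) - S) ^ 2) / (n * δ ^ 2) := by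
  obtain ⟨f, hfdef⟩ : ∃ f : ι → ℝ, ∀ i, f i = -Real.logb 2 (p i) - S := ⟨_, fun _ => rfl⟩
  simp only [← hfdef]
  have hf : ∑ i, p i * f i = 0 := by
    simp only [hfdef, mul_sub, Finset.sum_sub_distrib, ← Finset.sum_mul, hp, mul_neg,
      Finset.sum_neg_distrib]
    rw [hS]; ring
  have hnδ : 0 < (n : ℝ) * δ := by positivity
  have key : ∀ x ∈ s, ∏ t, p (x t) ≤
      (∏ t, p (x t)) * (∑ t, f (x t)) ^ 2 / (n * δ) ^ 2 := by
    intro x hx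
    have h0 : 0 ≤ ∏ t, p (x t) := Finset.prod_nonneg fun t _ => hp0 _
    -- Probability zero is treated apart: the logarithm of the product splits only when every factor
    -- is nonzero.
    rcases h0.eq_or_lt with h | h
    · simp [← h]
    · have hne : ∀ t ∈ Finset.univ, p (x t) ≠ 0 := Finset.prod_ne_zero_iff.1 h.ne'
      have h1 : ∑ t, f (x t) = -Real.logb 2 (∏ t, p (x t)) - n * S := by
        rw [Real.logb_prod _ _ hne]
        simp [hfdef, Finset.sum_sub_distrib, Finset.sum_neg_distrib]
      have h2 : (n * δ) ^ 2 ≤ (∑ t, f (x t)) ^ 2 := by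
        rw [h1, ← sq_abs (_ - _)]
        exact pow_le_pow_left₀ hnδ.le (hs x hx h) 2
      rw [le_div_iff₀ (by positivity)]
      exact mul_le_mul_of_nonneg_left h2 h0
  have hnn : ∀ x : Fin n → ι, 0 ≤ (∏ t, p (x t)) * (∑ t, f (x t)) ^ 2 / (n * δ) ^ 2 := fun x =>
    div_nonneg (mul_nonneg (Finset.prod_nonneg fun t _ => hp0 _) (sq_nonneg _)) (sq_nonneg _)
  have hle := (Finset.sum_le_sum key).trans (Finset.sum_le_univ_sum_of_nonneg hnn)
  rw [← Finset.sum_div, sum_prod_mul_sum_sq hp hf] at hle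
  refine hle.trans (le_of_eq ?_)
  have : (n : ℝ) ≠ 0 := by positivity
  rw [div_eq_div_iff (by positivity) (by positivity)]
  ring

/-- Asymptotic equipartition: sequences whose empirical entropy deviates from the entropy by at
least `δ` are eventually negligible. -/
theorem eventually_sum_le_of_entropy_deviation {p : ι → ℝ} (hp0 : ∀ i, 0 ≤ p i)
    (hp : ∑ i, p i = 1) {S : ℝ} (hS : S = -∑ i, p i * Real.logb 2 (p i))
    {δ : ℝ} (hδ : 0 < δ) {η : ℝ} (hη : 0 < η) :
    ∀ᶠ n : ℕ in atTop, ∀ s : Finset (Fin n → ι),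
      (∀ x ∈ s, 0 < ∏ t, p (x t) →
        n * δ ≤ |-Real.logb 2 (∏ t, p (x t)) - n * S|) →
      ∑ x ∈ s, ∏ t, p (x t) ≤ η := by
  set V := ∑ i, p i * (-Real.logb 2 (p i) - S) ^ 2 with hV
  have hlim : Tendsto (fun n : ℕ => V / δ ^ 2 / n) atTop (nhds 0) :=
    tendsto_const_div_atTop_nhds_zero_nat _
  filter_upwards [hlim.eventually_lt_const hη, eventually_gt_atTop 0] with n hn hn0 s hs
  refine (sum_le_of_entropy_deviation hp0 hp hS hδ hn0 s hs).trans ?_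
  rw [← hV]
  refine le_trans (le_of_eq ?_) hn.le
  rw [div_div, mul_comm]

end TypicalSequences

/-! ### Completely positive maps and positive semidefinite matrices. -/

section CompletelyPositive

theorem ampliation_eq_sum_kronecker {a b ι k : Type*} [Fintype a] [Fintype ι] [Fintype k] [DecidableEq k]
    {Φ : Matrix a a ℂ →ₗ[ℂ] Matrix b b ℂ} {K : ι → Matrix b a ℂ}
    (h : ∀ X, Φ X = ∑ i, K i * X * (K i)ᴴ) (X : Matrix (a × k) (a × k) ℂ) :
    ampliation Φ X = ∑ i, (K i ⊗ₖ (1 : Matrix k k ℂ)) * X * (K i ⊗ₖ (1 : Matrix k k ℂ))ᴴ := by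
  ext p q
  simp only [ampliation, of_apply, h, Matrix.sum_apply]
  refine Finset.sum_congr rfl fun i _ => ?_
  simp only [mul_apply, conjTranspose_apply, kroneckerMap_apply, of_apply, one_apply,
    Fintype.sum_prod_type, Finset.sum_mul, mul_ite, mul_one, mul_zero, ite_mul, zero_mul,
    star_zero, Finset.sum_ite_eq, Finset.mem_univ, if_true, apply_ite star]

variable {a b ι : Type*} [Fintype a] [Fintype b] [Fintype ι]

theorem isCPTP_of_kraus [DecidableEq a] {Φ : Matrix a a ℂ →ₗ[ℂ] Matrix b b ℂ}
    {K : ι → Matrix b a ℂ} (h : ∀ X, Φ X = ∑ i, K i * X * (K i)ᴴ)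
    (hK : ∑ i, (K i)ᴴ * K i = 1) : IsCPTP Φ where
  completely_positive k X hX := by
    rw [ampliation_eq_sum_kronecker h]
    exact posSemidef_sum _ fun i _ => hX.mul_mul_conjTranspose_same _
  trace_preserving X := by
    rw [h, trace_sum]
    simp_rw [fun i => trace_mul_cycle (K i) X (K i)ᴴ]
    rw [← trace_sum, ← Finset.sum_mul, hK, one_mul]

/-- With a one-dimensional ancilla the ampliation is `Φ` itself, up to reindexing. -/
theorem IsCPTP.map_posSemidef {Φ : Matrix a a ℂ →ₗ[ℂ] Matrix b b ℂ} (hΦ : IsCPTP Φ)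
    {X : Matrix a a ℂ} (hX : X.PosSemidef) : (Φ X).PosSemidef :=
  (hΦ.completely_positive 1 (X.submatrix Prod.fst Prod.fst) (hX.submatrix _)).submatrix
    fun i => (i, 0)

theorem IsCPTP.map_isDensity {Φ : Matrix a a ℂ →ₗ[ℂ] Matrix b b ℂ} (hΦ : IsCPTP Φ)
    {X : Matrix a a ℂ} (hX : IsDensity X) : IsDensity (Φ X) :=
  ⟨hΦ.map_posSemidef hX.1, (hΦ.trace_preserving X).trans hX.2⟩

/-- `IsCPTP` tests only the ancillas `Fin k`; an enumeration transports positivity to any finite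
ancilla. -/
theorem IsCPTP.ampliation_posSemidef {k : Type*} [Fintype k]
    {Φ : Matrix a a ℂ →ₗ[ℂ] Matrix b b ℂ} (hΦ : IsCPTP Φ)
    {X : Matrix (a × k) (a × k) ℂ} (hX : X.PosSemidef) : (ampliation Φ X).PosSemidef := by
  have h := hΦ.completely_positive _ _
    (hX.submatrix (Prod.map id (Fintype.equivFin k).symm))
  convert h.submatrix (Prod.map id (Fintype.equivFin k)) using 1
  ext p q
  simp [ampliation]

/-- Density matrices are bounded by the identity. -/
theorem IsDensity.one_sub_posSemidef [DecidableEq a] {τ : Matrix a a ℂ} (hτ : IsDensity τ) :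
    (1 - τ).PosSemidef := by
  have hH := hτ.1.isHermitian
  have hsum : ∑ i, hH.eigenvalues i = 1 := by
    have := hH.trace_eq_sum_eigenvalues
    rw [hτ.2] at this
    rw [← Complex.ofReal_inj]
    simpa using this.symm
  set U : Matrix a a ℂ := hH.eigenvectorUnitary.1 with hU
  have hUU : U * Uᴴ = 1 := Unitary.coe_mul_star_self hH.eigenvectorUnitary
  have hs : τ = U * diagonal (fun i => (hH.eigenvalues i : ℂ)) * Uᴴ := hH.spectral_theorem
  have : 1 - τ = U * diagonal (fun i => ((1 - hH.eigenvalues i : ℝ) : ℂ)) * Uᴴ := by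
    have hd : diagonal (fun i => ((1 - hH.eigenvalues i : ℝ) : ℂ)) =
        1 - diagonal (fun i => (hH.eigenvalues i : ℂ)) := by
      rw [← diagonal_one, diagonal_sub]; simp
    rw [hd, Matrix.mul_sub, Matrix.sub_mul, Matrix.mul_one, hUU, ← hs]
  rw [this]
  refine PosSemidef.mul_mul_conjTranspose_same (PosSemidef.diagonal fun i => ?_) U
  have : hH.eigenvalues i ≤ 1 := by
    rw [← hsum]
    exact Finset.single_le_sum (fun j _ => hτ.1.eigenvalues_nonneg j) (Finset.mem_univ i)
  exact Complex.zero_le_real.2 (sub_nonneg.2 this)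

/-- Spectral decomposition of a positive semidefinite matrix with unnormalized eigenvectors. -/
theorem Matrix.PosSemidef.exists_orthogonal_factor [DecidableEq a] {W : Matrix a a ℂ}
    (hW : W.PosSemidef) :
    ∃ V : Matrix a a ℂ, W = V * Vᴴ ∧ ∀ i j, i ≠ j → (Vᴴ * V) i j = 0 := by
  have hH := hW.isHermitian
  set U : Matrix a a ℂ := hH.eigenvectorUnitary.1 with hU
  have hUU : Uᴴ * U = 1 := Unitary.coe_star_mul_self hH.eigenvectorUnitary
  have hs : W = U * diagonal (fun i => (hH.eigenvalues i : ℂ)) * Uᴴ := hH.spectral_theorem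
  have hstar : (diagonal fun i => ((√(hH.eigenvalues i) : ℝ) : ℂ))ᴴ =
      diagonal fun i => ((√(hH.eigenvalues i) : ℝ) : ℂ) := by
    rw [diagonal_conjTranspose]; congr 1; ext i; simp
  have hsq : ∀ i, ((√(hH.eigenvalues i) : ℝ) : ℂ) * ((√(hH.eigenvalues i) : ℝ) : ℂ) =
      (hH.eigenvalues i : ℂ) := fun i => by
    rw [← Complex.ofReal_mul, Real.mul_self_sqrt (hW.eigenvalues_nonneg i)]
  refine ⟨U * diagonal fun i => ((√(hH.eigenvalues i) : ℝ) : ℂ), ?_, fun i j hij => ?_⟩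
  · rw [conjTranspose_mul, hstar, Matrix.mul_assoc U, ← Matrix.mul_assoc (diagonal _),
      diagonal_mul_diagonal, ← Matrix.mul_assoc]
    simp only [hsq]
    exact hs
  · rw [conjTranspose_mul, hstar, Matrix.mul_assoc, ← Matrix.mul_assoc Uᴴ, hUU, Matrix.one_mul,
      diagonal_mul_diagonal, diagonal_apply_ne _ hij]

end CompletelyPositive

/-! ### Partial isometries and the compression channel. -/

section PartialIsometry

variable {a b : Type*} [Fintype a] [Fintype b]

theorem pureFidelity_nonneg {v : a → ℂ} {ρ : Matrix a a ℂ} (hρ : ρ.PosSemidef) :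
    0 ≤ pureFidelity v ρ :=
  hρ.re_dotProduct_nonneg v

theorem pureFidelity_mono {v : a → ℂ} {ρ σ : Matrix a a ℂ} (h : (σ - ρ).PosSemidef) :
    pureFidelity v ρ ≤ pureFidelity v σ := by
  have := pureFidelity_nonneg (v := v) h
  simpa [pureFidelity, sub_mulVec, dotProduct_sub] using this

theorem conjTranspose_one_sub_mul_self_of_partialIsometry [DecidableEq a] {A : Matrix b a ℂ}
    (hA : A * Aᴴ * A = A) :
    (1 - Aᴴ * A)ᴴ * (1 - Aᴴ * A) = 1 - Aᴴ * A := by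
  have h : Aᴴ * A * (Aᴴ * A) = Aᴴ * A := by
    rw [Matrix.mul_assoc, ← Matrix.mul_assoc A, hA]
  simp [sub_mul, mul_sub, h]

/-- Compressing a positive semidefinite matrix with a partial isometry decreases the trace. -/
theorem sum_pureFidelity_col_le_trace {Φ : Matrix a b ℂ} (hΦ : Φ * Φᴴ * Φ = Φ)
    {ρ : Matrix a a ℂ} (hρ : ρ.PosSemidef) :
    ∑ x, pureFidelity (fun i => Φ i x) ρ ≤ ρ.trace.re := by
  classical
  have hsum : ∑ x, pureFidelity (fun i => Φ i x) ρ = (Φᴴ * ρ * Φ).trace.re := by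
    rw [trace, Complex.re_sum]
    refine Finset.sum_congr rfl fun x _ => ?_
    rw [pureFidelity, diag_apply, Matrix.mul_assoc, mul_apply]
    rfl
  have hA : Φᴴ * Φᴴᴴ * Φᴴ = Φᴴ := by
    simpa [Matrix.mul_assoc] using congrArg conjTranspose hΦ
  have hQ := conjTranspose_one_sub_mul_self_of_partialIsometry hA
  set Q := 1 - Φᴴᴴ * Φᴴ with hQdef
  -- Since `Q = 1 - ΦΦ†` is a projection, cyclicity turns this into tr(ΦΦ†ρ) ≤ tr ρ.
  have h0 : 0 ≤ (Q * ρ * Qᴴ).trace := (hρ.mul_mul_conjTranspose_same Q).trace_nonneg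
  rw [trace_mul_cycle, hQ, hQdef, conjTranspose_conjTranspose, sub_mul, trace_sub, one_mul] at h0
  have h1 := (Complex.le_def.1 h0).1
  rw [hsum, trace_mul_cycle]
  simpa using h1

/-- The operation that applies `A` and, when that fails, prepares the basis state `o`. -/
def compressionMap [DecidableEq a] [DecidableEq b] (A : Matrix b a ℂ) (o : b) :
    Matrix a a ℂ →ₗ[ℂ] Matrix b b ℂ where
  toFun X := A * X * Aᴴ + ((1 - Aᴴ * A) * X).trace • single o o (1 : ℂ)
  map_add' X Y := by
    simp only [Matrix.mul_add, Matrix.add_mul, trace_add, add_smul]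
    abel
  map_smul' c X := by
    simp [smul_add, mul_smul]

variable [DecidableEq a] [DecidableEq b]

theorem compressionMap_apply (A : Matrix b a ℂ) (o : b) (X : Matrix a a ℂ) :
    compressionMap A o X = A * X * Aᴴ + ((1 - Aᴴ * A) * X).trace • single o o (1 : ℂ) := rfl

theorem isCPTP_compressionMap {A : Matrix b a ℂ} (hA : A * Aᴴ * A = A) (o : b) :
    IsCPTP (compressionMap A o) := by
  have hQ := conjTranspose_one_sub_mul_self_of_partialIsometry hA
  set Q := 1 - Aᴴ * A with hQdef
  -- The Kraus operators are `A` for success and |o⟩⟨k|Q, over all basis vectors k, for failure. As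
  -- Q is a projection, the latter add up to tr(QX)|o⟩⟨o|.
  refine isCPTP_of_kraus (ι := Option a)
    (K := fun k => k.elim A fun k => single o k (1 : ℂ) * Q) (fun X => ?_) ?_
  · rw [compressionMap_apply, Fintype.sum_option, ← hQdef]
    simp only [Option.elim_none, Option.elim_some]
    congr 1
    have h1 : ∀ k : a, single o k (1 : ℂ) * Q * X * (single o k (1 : ℂ) * Q)ᴴ =
        (Q * X * Qᴴ) k k • single o o (1 : ℂ) := by
      intro k
      rw [conjTranspose_mul, conjTranspose_single, star_one]
      have : single o k (1 : ℂ) * Q * X * (Qᴴ * single k o (1 : ℂ)) =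
        single o k (1 : ℂ) * (Q * X * Qᴴ) * single k o (1 : ℂ) := by simp only [Matrix.mul_assoc]
      rw [this, single_mul_mul_single]
      simp [smul_single]
    simp only [h1]
    rw [← Finset.sum_smul]
    congr 1
    calc (Q * X).trace = (Qᴴ * Q * X).trace := by rw [hQ]
      _ = (Q * X * Qᴴ).trace := (trace_mul_cycle Q X Qᴴ).symm
  · rw [Fintype.sum_option]
    simp only [Option.elim_none, Option.elim_some, conjTranspose_mul, conjTranspose_single,
      star_one]
    have h1 : ∀ k : a, Qᴴ * single k o (1 : ℂ) * (single o k (1 : ℂ) * Q) = Qᴴ * (single k k (1 : ℂ) * Q) := by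
      intro k
      rw [Matrix.mul_assoc, ← Matrix.mul_assoc (single k o (1 : ℂ)), single_mul_single_same, one_mul]
    simp only [h1]
    rw [← Finset.mul_sum, ← Finset.sum_mul]
    have h2 : ∑ k : a, single k k (1 : ℂ) = 1 := by
      rw [← diagonal_one, ← sum_single_eq_diagonal]
    rw [h2, one_mul, hQ, hQdef]
    abel

theorem compressionMap_sub_posSemidef {A : Matrix b a ℂ} (hA : A * Aᴴ * A = A) (o : b)
    {X : Matrix a a ℂ} (hX : X.PosSemidef) :
    (compressionMap A o X - A * X * Aᴴ).PosSemidef := by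
  have hQ := conjTranspose_one_sub_mul_self_of_partialIsometry hA
  rw [compressionMap_apply, add_sub_cancel_left]
  refine PosSemidef.smul ?_ ?_
  · have := posSemidef_vecMulVec_self_star (Pi.single o (1 : ℂ) : b → ℂ)
    convert this
    rw [single_eq_single_vecMulVec_single]
    congr 1
    ext i; simp [Pi.single_apply, apply_ite star]
  · rw [← hQ, ← trace_mul_cycle]
    exact (hX.mul_mul_conjTranspose_same _).trace_nonneg

/-- Compression followed by decompression preserves a pure state `v` with fidelity at least
`⟨v|A†A|v⟩²`. -/
theorem le_pureFidelity_compressionMap {A : Matrix b a ℂ} (hA : A * Aᴴ * A = A) (o : b) (o' : a)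
    (v : a → ℂ) :
    pureFidelity v (Aᴴ * A) ^ 2 ≤
      pureFidelity v (compressionMap Aᴴ o' (compressionMap A o (vecMulVec v (star v)))) := by
  have hA' : Aᴴ * Aᴴᴴ * Aᴴ = Aᴴ := by
    simpa [Matrix.mul_assoc] using congrArg conjTranspose hA
  have hX : (vecMulVec v (star v)).PosSemidef := posSemidef_vecMulVec_self_star v
  -- The failure terms of both operations are positive semidefinite and can be dropped. What remains
  -- is P|v⟩⟨v|P with P = A†A, whose fidelity with v is ⟨v|P|v⟩².
  have h1 := compressionMap_sub_posSemidef hA' o' ((isCPTP_compressionMap hA o).map_posSemidef hX)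
  have h2 := (compressionMap_sub_posSemidef hA o hX).conjTranspose_mul_mul_same A
  refine le_trans ?_ ((pureFidelity_mono (σ := Aᴴ * compressionMap A o (vecMulVec v (star v)) * A)
    (by rw [← Matrix.sub_mul, ← Matrix.mul_sub]; exact h2)).trans
      (pureFidelity_mono (by simpa using h1)))
  have hr : (star v ⬝ᵥ ((Aᴴ * A) *ᵥ v)).im = 0 := by
    have h := (posSemidef_conjTranspose_mul_self A).dotProduct_mulVec_nonneg v
    exact (Complex.le_def.1 h).2.symm
  have h3 : star v ⬝ᵥ ((Aᴴ * (A * vecMulVec v (star v) * Aᴴ) * A) *ᵥ v) =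
      (star v ⬝ᵥ ((Aᴴ * A) *ᵥ v)) * (star v ⬝ᵥ ((Aᴴ * A) *ᵥ v)) := by
    have : Aᴴ * (A * vecMulVec v (star v) * Aᴴ) * A =
        (Aᴴ * A) * vecMulVec v (star v) * (Aᴴ * A) := by simp only [Matrix.mul_assoc]
    rw [this, ← mulVec_mulVec, ← mulVec_mulVec, vecMulVec_mulVec, mulVec_smul, dotProduct_smul]
    simp
  rw [pureFidelity, pureFidelity, h3, Complex.mul_re, hr]
  simp [sq]

end PartialIsometry

/-! ### Kraus operators as bipartite vectors. -/

section KrausVectors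

variable {d : Type*} [Fintype d] [DecidableEq d]

theorem krausVec_apply (M : Matrix d d ℂ) (p : d × d) :
    krausVec M p = M p.1 p.2 * ((√(Fintype.card d : ℝ))⁻¹ : ℝ) := by
  obtain ⟨i, j⟩ := p
  simp only [krausVec, mulVec, dotProduct, kroneckerMap_apply, one_apply, maxEntangled,
    Fintype.sum_prod_type, mul_ite, mul_one, mul_zero, ite_mul, zero_mul]
  simp [Finset.sum_ite_eq]

theorem inv_sqrt_card_mul_self (d : Type*) [Fintype d] :
    (((√(Fintype.card d : ℝ))⁻¹ : ℝ) : ℂ) * (((√(Fintype.card d : ℝ))⁻¹ : ℝ) : ℂ) =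
      (Fintype.card d : ℂ)⁻¹ := by
  rw [← Complex.ofReal_mul, ← mul_inv, Real.mul_self_sqrt (Nat.cast_nonneg _)]
  simp

theorem star_krausVec_dotProduct (A B : Matrix d d ℂ) :
    star (krausVec A) ⬝ᵥ krausVec B = (Aᴴ * B).trace * (Fintype.card d : ℂ)⁻¹ := by
  rw [← inv_sqrt_card_mul_self, trace]
  simp only [dotProduct, Pi.star_apply, krausVec_apply, diag_apply, mul_apply,
    conjTranspose_apply, Fintype.sum_prod_type_right, Finset.sum_mul, star_mul', RCLike.star_def,
    Complex.conj_ofReal]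
  exact Finset.sum_congr rfl fun i _ => Finset.sum_congr rfl fun j _ => by ring

theorem vecMulVec_krausVec_apply (A B : Matrix d d ℂ) (p q : d × d) :
    vecMulVec (krausVec A) (star (krausVec B)) p q =
      A p.1 p.2 * star (B q.1 q.2) * (Fintype.card d : ℂ)⁻¹ := by
  rw [← inv_sqrt_card_mul_self, vecMulVec_apply, Pi.star_apply, krausVec_apply, krausVec_apply,
    star_mul', RCLike.star_def, Complex.conj_ofReal]
  ring

theorem krausWeight_nonneg (M : Matrix d d ℂ) : 0 ≤ krausWeight M :=
  Finset.sum_nonneg fun _ _ => sq_nonneg _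

theorem ofReal_krausWeight (M : Matrix d d ℂ) :
    (krausWeight M : ℂ) = star (krausVec M) ⬝ᵥ krausVec M := by
  rw [krausWeight, Complex.ofReal_sum]
  refine Finset.sum_congr rfl fun p _ => ?_
  rw [Pi.star_apply, RCLike.star_def, Complex.conj_mul']
  simp

theorem ofReal_krausWeight_eq_trace (M : Matrix d d ℂ) :
    (krausWeight M : ℂ) = (Mᴴ * M).trace * (Fintype.card d : ℂ)⁻¹ := by
  rw [ofReal_krausWeight, star_krausVec_dotProduct]

/-- At weight zero the vector itself vanishes by definiteness, so the identities derived from this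
one need no case distinction. -/
theorem krausVec_eq_smul_krausState (M : Matrix d d ℂ) :
    krausVec M = √(krausWeight M) • krausState M := by
  rcases (krausWeight_nonneg M).eq_or_lt with h | h
  · have h0 : krausVec M = 0 := by
      have : star (krausVec M) ⬝ᵥ krausVec M = 0 := by rw [← ofReal_krausWeight, ← h]; simp
      exact dotProduct_star_self_eq_zero.1 this
    simp [krausState, h0]
  · rw [krausState, smul_smul, mul_inv_cancel₀ (Real.sqrt_pos.2 h).ne', one_smul]

theorem krausState_eq_zero {M : Matrix d d ℂ} (h : krausWeight M = 0) : krausState M = 0 := by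
  simp [krausState, h]

theorem star_krausState_dotProduct (A B : Matrix d d ℂ) :
    star (krausState A) ⬝ᵥ krausState B =
      (((√(krausWeight A))⁻¹ * (√(krausWeight B))⁻¹ : ℝ) : ℂ) *
        (star (krausVec A) ⬝ᵥ krausVec B) := by
  simp only [krausState, star_smul, smul_dotProduct, dotProduct_smul, Complex.real_smul,
    star_trivial (√(krausWeight A))⁻¹]
  push_cast
  ring

theorem star_krausState_dotProduct_self {M : Matrix d d ℂ} (h : krausWeight M ≠ 0) :
    star (krausState M) ⬝ᵥ krausState M = 1 := by
  have h' : √(krausWeight M) ≠ 0 :=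
    (Real.sqrt_pos.2 ((krausWeight_nonneg M).lt_of_ne' h)).ne'
  rw [star_krausState_dotProduct, ← ofReal_krausWeight, ← Complex.ofReal_mul, ← mul_inv,
    Real.mul_self_sqrt (krausWeight_nonneg M), inv_mul_cancel₀ h, Complex.ofReal_one]

theorem krausWeight_smul_vecMulVec_krausState (M : Matrix d d ℂ) :
    (krausWeight M : ℂ) • vecMulVec (krausState M) (star (krausState M)) =
      vecMulVec (krausVec M) (star (krausVec M)) := by
  conv_rhs => rw [krausVec_eq_smul_krausState]
  rw [star_smul, smul_vecMulVec, vecMulVec_smul, smul_smul, star_trivial √(krausWeight M),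
    Real.mul_self_sqrt (krausWeight_nonneg M)]
  ext; simp

theorem krausWeight_mul_pureFidelity_krausState (M : Matrix d d ℂ)
    (ρ : Matrix (d × d) (d × d) ℂ) :
    krausWeight M * pureFidelity (krausState M) ρ = pureFidelity (krausVec M) ρ := by
  conv_rhs => rw [krausVec_eq_smul_krausState]
  rw [pureFidelity, pureFidelity, star_smul, mulVec_smul, smul_dotProduct, dotProduct_smul,
    smul_smul, star_trivial √(krausWeight M), Real.mul_self_sqrt (krausWeight_nonneg M), Complex.smul_re,
    smul_eq_mul]

theorem pureFidelity_eq_trace {a : Type*} [Fintype a] (v : a → ℂ) (ρ : Matrix a a ℂ) :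
    pureFidelity v ρ = (ρ * vecMulVec v (star v)).trace.re := by
  rw [mul_vecMulVec, trace_vecMulVec, dotProduct_comm, pureFidelity]

theorem isDensity_vecMulVec_krausState {M : Matrix d d ℂ} (h : krausWeight M ≠ 0) :
    IsDensity (vecMulVec (krausState M) (star (krausState M))) :=
  ⟨posSemidef_vecMulVec_self_star _, by
    rw [trace_vecMulVec, dotProduct_comm, star_krausState_dotProduct_self h]⟩

/-- The normalized vectors of pairwise orthogonal Kraus operators form the columns of a partial
isometry. -/
theorem krausState_partialIsometry {ι : Type*} [Fintype ι] {M : ι → Matrix d d ℂ}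
    (hM : ∀ i j, i ≠ j → ((M i)ᴴ * M j).trace = 0) :
    let Φ : Matrix (d × d) ι ℂ := of fun p i => krausState (M i) p
    Φ * Φᴴ * Φ = Φ := by
  classical
  intro Φ
  ext p j
  rw [Matrix.mul_assoc, mul_apply, Finset.sum_eq_single j]
  · have h : (Φᴴ * Φ) j j = star (krausState (M j)) ⬝ᵥ krausState (M j) := rfl
    by_cases hw : krausWeight (M j) = 0
    · simp [Φ, krausState_eq_zero hw]
    · rw [h, star_krausState_dotProduct_self hw, mul_one]
  · intro i _ hij
    have h : (Φᴴ * Φ) i j = star (krausState (M i)) ⬝ᵥ krausState (M j) := rfl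
    rw [h, star_krausState_dotProduct, star_krausVec_dotProduct, hM i j hij]
    simp
  · simp

end KrausVectors

/-! ### The Choi state, its diagonal decompositions and its spectrum. -/

section ChoiState

variable {d : Type*} [Fintype d] [DecidableEq d] {E : Matrix d d ℂ →ₗ[ℂ] Matrix d d ℂ}

theorem choiState_apply (E : Matrix d d ℂ →ₗ[ℂ] Matrix d d ℂ) (p q : d × d) :
    choiState E p q = E (single p.2 q.2 1) p.1 q.1 * (Fintype.card d : ℂ)⁻¹ := by
  have h : (of fun i j => vecMulVec (maxEntangled d) (star (maxEntangled d)) (i, p.2) (j, q.2)) =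
      (Fintype.card d : ℂ)⁻¹ • (single p.2 q.2 1 : Matrix d d ℂ) := by
    ext i j
    rw [← inv_sqrt_card_mul_self]
    simp only [of_apply, vecMulVec_apply, maxEntangled, Pi.star_apply, Matrix.smul_apply, single_apply,
      smul_eq_mul]
    by_cases h1 : p.2 = i <;> by_cases h2 : q.2 = j <;>
      simp [h1, h2, eq_comm (a := i), eq_comm (a := j)]
  rw [choiState, ampliation, of_apply, h, map_smul, Matrix.smul_apply, smul_eq_mul, mul_comm]

theorem choiState_posSemidef (hE : IsCPTP E) : (choiState E).PosSemidef :=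
  hE.ampliation_posSemidef (posSemidef_vecMulVec_self_star _)

theorem IsKraus.map_single {ι : Type*} [Fintype ι] {M : ι → Matrix d d ℂ} (h : IsKraus E M)
    (j j' i i' : d) : E (single j j' 1) i i' = ∑ k, M k i j * star (M k i' j') := by
  rw [h, Matrix.sum_apply]
  refine Finset.sum_congr rfl fun k _ => ?_
  simp [mul_apply, single_apply, Finset.sum_ite_eq, ite_and]

theorem IsKraus.choiState_eq {ι : Type*} [Fintype ι] {M : ι → Matrix d d ℂ} (h : IsKraus E M) :
    choiState E = ∑ k, vecMulVec (krausVec (M k)) (star (krausVec (M k))) := by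
  ext p q
  rw [choiState_apply, h.map_single, Matrix.sum_apply, Finset.sum_mul]
  exact Finset.sum_congr rfl fun k _ => (vecMulVec_krausVec_apply _ _ _ _).symm

/-- Matrix units span, and their images are the entries of the Choi state up to a scalar
(`choiState_apply`). Thus Kraus operators can be read off from a decomposition of the Choi state. -/
theorem isKraus_of_map_single {ι : Type*} [Fintype ι] {M : ι → Matrix d d ℂ}
    (h : ∀ j j' i i' : d, E (single j j' 1) i i' = ∑ k, M k i j * star (M k i' j')) :
    IsKraus E M := by
  intro ρ
  ext i i'
  conv_lhs => rw [matrix_eq_sum_single ρ]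
  have hs : ∀ j j', single j j' (ρ j j') = ρ j j' • (single j j' 1 : Matrix d d ℂ) := by
    intro j j'; simp
  simp only [map_sum, Matrix.sum_apply, hs, map_smul, Matrix.smul_apply, h, smul_eq_mul,
    mul_apply, conjTranspose_apply, Finset.mul_sum, Finset.sum_mul]
  rw [Finset.sum_comm]
  simp_rw [Finset.sum_comm (s := Finset.univ (α := d)) (t := Finset.univ (α := ι))]
  refine Finset.sum_congr rfl fun k _ => Finset.sum_congr rfl fun j _ =>
    Finset.sum_congr rfl fun j' _ => by ring

theorem exists_isDiagonalKraus [Nonempty d] (hE : IsCPTP E) :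
    ∃ (r : ℕ) (M : Fin r → Matrix d d ℂ), IsDiagonalKraus E M := by
  obtain ⟨V, hV, hort⟩ := (choiState_posSemidef hE).exists_orthogonal_factor
  -- The factor √d undoes the normalization of ψ⁺: the Kraus operators are the columns of `V`,
  -- reshaped into square matrices and multiplied by `c`.
  set c : ℂ := ((√(Fintype.card d : ℝ) : ℝ) : ℂ) with hc
  have hcard : (Fintype.card d : ℂ) ≠ 0 := by simp
  have hcc : c * star c = Fintype.card d := by
    rw [hc, RCLike.star_def, Complex.conj_ofReal, ← Complex.ofReal_mul,
      Real.mul_self_sqrt (Nat.cast_nonneg _)]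
    simp
  let e := (Fintype.equivFin (d × d)).symm
  refine ⟨Fintype.card (d × d), fun k => of fun i j => c * V (i, j) (e k), ⟨?_, ?_⟩⟩
  · refine isKraus_of_map_single fun j j' i i' => ?_
    have h := choiState_apply E (i, j) (i', j')
    rw [eq_mul_inv_iff_mul_eq₀ hcard, hV, mul_apply] at h
    rw [← h, e.sum_comp fun k => (of fun i j => c * V (i, j) k) i j *
      star ((of fun i j => c * V (i, j) k) i' j'), Finset.sum_mul]
    refine Finset.sum_congr rfl fun k _ => ?_
    simp only [of_apply, star_mul', conjTranspose_apply]
    rw [← hcc]; ring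
  · intro k l hkl
    have h := hort (e k) (e l) (e.injective.ne hkl)
    rw [mul_apply, Fintype.sum_prod_type_right] at h
    rw [trace]
    simp only [diag_apply, mul_apply, conjTranspose_apply, of_apply, star_mul'] at h ⊢
    rw [← mul_zero (star c * c), ← h, Finset.mul_sum]
    refine Finset.sum_congr rfl fun j _ => ?_
    rw [Finset.mul_sum]
    exact Finset.sum_congr rfl fun i _ => by ring

theorem IsKraus.sum_krausWeight [Nonempty d] (hE : IsCPTP E) {ι : Type*} [Fintype ι]
    {M : ι → Matrix d d ℂ} (h : IsKraus E M) : ∑ k, krausWeight (M k) = 1 := by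
  have hcard : (Fintype.card d : ℂ) ≠ 0 := by simp
  have h1 : ∑ k, ((M k)ᴴ * M k).trace = Fintype.card d := by
    have := hE.trace_preserving 1
    rw [h, trace_sum, trace_one] at this
    rw [← this]
    exact Finset.sum_congr rfl fun k _ => by rw [mul_one, trace_mul_comm]
  rw [← Complex.ofReal_inj, Complex.ofReal_sum]
  simp only [ofReal_krausWeight_eq_trace]
  rw [← Finset.sum_mul, h1, mul_inv_cancel₀ hcard, Complex.ofReal_one]

theorem Multiset.filter_ne_zero_replicate_zero {R : Type*} [Zero R] [DecidableEq R] (n : ℕ) :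
    (Multiset.replicate n (0 : R)).filter (· ≠ 0) = 0 := by
  rw [Multiset.filter_eq_nil]
  intro a ha
  simp [Multiset.eq_of_mem_replicate ha]

theorem IsDiagonalKraus.filter_roots_charpoly {ι : Type*} [Fintype ι] {M : ι → Matrix d d ℂ}
    (h : IsDiagonalKraus E M) :
    (choiState E).charpoly.roots.filter (· ≠ 0) =
      (Finset.univ.val.map fun μ => (krausWeight (M μ) : ℂ)).filter (· ≠ 0) := by
  classical
  let V : Matrix (d × d) ι ℂ := of fun p i => krausVec (M i) p
  have h1 : choiState E = V * Vᴴ := by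
    rw [h.isKraus.choiState_eq]
    ext p q
    rw [Matrix.sum_apply]
    rfl
  have h2 : Vᴴ * V = diagonal fun μ => (krausWeight (M μ) : ℂ) := by
    ext i j
    have hij : (Vᴴ * V) i j = star (krausVec (M i)) ⬝ᵥ krausVec (M j) := rfl
    rw [hij]
    by_cases he : i = j
    · subst he
      rw [diagonal_apply_eq, ofReal_krausWeight]
    · rw [diagonal_apply_ne _ he, star_krausVec_dotProduct, h.trace_orthogonal i j he, zero_mul]
  -- VV† and V†V have the same characteristic polynomial up to powers of X, and V†V is the diagonal
  -- Gram matrix of the Kraus vectors.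
  have h3 := charpoly_mul_comm' V Vᴴ
  rw [← h1, h2, charpoly_diagonal] at h3
  have h4 := congrArg (fun P : Polynomial ℂ => P.roots.filter (· ≠ 0)) h3
  have hprod : ∏ μ, (Polynomial.X - Polynomial.C (krausWeight (M μ) : ℂ)) ≠ 0 :=
    Finset.prod_ne_zero_iff.2 fun μ _ => Polynomial.X_sub_C_ne_zero _
  rw [Polynomial.roots_mul (mul_ne_zero (pow_ne_zero _ Polynomial.X_ne_zero)
      (charpoly_monic _).ne_zero),
    Polynomial.roots_mul (mul_ne_zero (pow_ne_zero _ Polynomial.X_ne_zero) hprod),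
    Polynomial.roots_X_pow, Polynomial.roots_X_pow, Multiset.filter_add, Multiset.filter_add,
    Multiset.nsmul_singleton, Multiset.nsmul_singleton, Multiset.filter_ne_zero_replicate_zero,
    Multiset.filter_ne_zero_replicate_zero, zero_add, zero_add] at h4
  rw [h4, Polynomial.roots_prod _ _ hprod]
  simp [Multiset.bind_singleton]

theorem Multiset.sum_map_filter_ne_zero {R S : Type*} [Zero R] [DecidableEq R] [AddCommMonoid S]
    (s : Multiset R) {f : R → S} (hf : f 0 = 0) : ((s.filter (· ≠ 0)).map f).sum = (s.map f).sum := by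
  induction s using Multiset.induction with
  | empty => simp
  | cons a s ih =>
    by_cases ha : a = 0 <;> simp_all

/-- The function z ↦ z log₂ z vanishes at 0, so the nonzero spectrum determines the entropy. -/
theorem IsDiagonalKraus.mapEntropy_eq {ι : Type*} [Fintype ι] {M : ι → Matrix d d ℂ}
    (h : IsDiagonalKraus E M) :
    mapEntropy E = -∑ μ, krausWeight (M μ) * Real.logb 2 (krausWeight (M μ)) := by
  rw [mapEntropy, ← Multiset.sum_map_filter_ne_zero _ (by simp), h.filter_roots_charpoly,
    Multiset.sum_map_filter_ne_zero _ (by simp), Multiset.map_map]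
  rfl

end ChoiState

/-! ### Sequences of Kraus operators. -/

section TensorPowers

variable {d : Type*} [Fintype d] [DecidableEq d] {E : Matrix d d ℂ →ₗ[ℂ] Matrix d d ℂ}

theorem trace_conjTranspose_tensorOp_mul {d : Type*} [Fintype d] {n : ℕ} (A B : Fin n → Matrix d d ℂ) :
    ((tensorOp A)ᴴ * tensorOp B).trace = ∏ t, ((A t)ᴴ * B t).trace := by
  simp only [trace, diag_apply, mul_apply, conjTranspose_apply, tensorOp, of_apply, star_prod,
    ← Finset.prod_mul_distrib]
  rw [← sum_prod_pi n fun t j => ∑ i, star (A t i j) * B t i j]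
  refine Finset.sum_congr rfl fun j _ => ?_
  rw [← sum_prod_pi n fun t i => star (A t i (j t)) * B t i (j t)]

theorem krausWeight_tensorOp {n : ℕ} (A : Fin n → Matrix d d ℂ) :
    krausWeight (tensorOp A) = ∏ t, krausWeight (A t) := by
  rw [← Complex.ofReal_inj, Complex.ofReal_prod]
  simp only [ofReal_krausWeight_eq_trace]
  rw [trace_conjTranspose_tensorOp_mul, Finset.prod_mul_distrib]
  simp

theorem tensorOp_trace_orthogonal {d ι : Type*} [Fintype d] {M : ι → Matrix d d ℂ}
    (hM : ∀ i j, i ≠ j → ((M i)ᴴ * M j).trace = 0) {n : ℕ} (x y : Fin n → ι) (hxy : x ≠ y) :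
    ((tensorOp fun t => M (x t))ᴴ * tensorOp fun t => M (y t)).trace = 0 := by
  obtain ⟨t, ht⟩ := Function.ne_iff.1 hxy
  rw [trace_conjTranspose_tensorOp_mul]
  exact Finset.prod_eq_zero (Finset.mem_univ t) (hM _ _ ht)

/-- The average state of the Kraus sequences does not depend on the Kraus representations. -/
theorem sum_vecMulVec_krausVec_tensorOp {n : ℕ} {ι : Type*} [Fintype ι]
    {M : Fin n → ι → Matrix d d ℂ} (hM : ∀ t, IsKraus E (M t)) :
    ∑ x : Fin n → ι, vecMulVec (krausVec (tensorOp fun t => M t (x t)))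
        (star (krausVec (tensorOp fun t => M t (x t)))) =
      of fun p q : (Fin n → d) × (Fin n → d) =>
        (∏ t, E (single (p.2 t) (q.2 t) 1) (p.1 t) (q.1 t)) *
          (Fintype.card (Fin n → d) : ℂ)⁻¹ := by
  ext p q
  simp only [Matrix.sum_apply, vecMulVec_krausVec_apply, tensorOp, of_apply, star_prod,
    ← Finset.prod_mul_distrib, ← Finset.sum_mul]
  rw [sum_prod_pi n fun t i => M t i (p.1 t) (p.2 t) * star (M t i (q.1 t) (q.2 t))]
  exact congrArg (· * _) (Finset.prod_congr rfl fun t _ => ((hM t).map_single _ _ _ _).symm)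

theorem sum_krausWeight_tensorOp [Nonempty d] (hE : IsCPTP E) {n : ℕ} {ι : Type*} [Fintype ι]
    {M : Fin n → ι → Matrix d d ℂ} (hM : ∀ t, IsKraus E (M t)) :
    ∑ x : Fin n → ι, krausWeight (tensorOp fun t => M t (x t)) = 1 := by
  simp only [krausWeight_tensorOp]
  rw [sum_prod_pi n fun t i => krausWeight (M t i)]
  exact Finset.prod_eq_one fun t _ => (hM t).sum_krausWeight hE

end TensorPowers

/-! ### Direct and converse parts of the storage theorem. -/

section Storage

variable {d : Type*} [Fintype d] [DecidableEq d] {E : Matrix d d ℂ →ₗ[ℂ] Matrix d d ℂ}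

theorem IsKraus.krausWeight_le_one [Nonempty d] (hE : IsCPTP E) {ι : Type*} [Fintype ι]
    {M : ι → Matrix d d ℂ} (h : IsKraus E M) (i : ι) : krausWeight (M i) ≤ 1 := by
  rw [← h.sum_krausWeight hE]
  exact Finset.single_le_sum (fun j _ => krausWeight_nonneg (M j)) (Finset.mem_univ i)

theorem mapEntropy_nonneg [Nonempty d] (hE : IsCPTP E) : 0 ≤ mapEntropy E := by
  obtain ⟨r, M, hM⟩ := exists_isDiagonalKraus hE
  rw [hM.mapEntropy_eq, neg_nonneg]
  exact Finset.sum_nonpos fun i _ => mul_nonpos_of_nonneg_of_nonpos (krausWeight_nonneg _)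
    (Real.logb_nonpos one_lt_two (krausWeight_nonneg _) (hM.isKraus.krausWeight_le_one hE i))

/-- Fidelity bound for the storage of orthogonal states in an `N`-dimensional memory: apart from
a set `s` of states, each of which may be stored perfectly, all states together contribute at most
`N` times the largest weight. -/
theorem sum_krausWeight_mul_pureFidelity_le {ι b : Type*} [Fintype ι] [DecidableEq ι] [Fintype b]
    [DecidableEq b] {M : ι → Matrix d d ℂ} (hM : ∀ i j, i ≠ j → ((M i)ᴴ * M j).trace = 0)
    {τ : ι → Matrix b b ℂ} (hτ : ∀ x, IsDensity (τ x))
    {D : Matrix b b ℂ →ₗ[ℂ] Matrix (d × d) (d × d) ℂ} (hD : IsCPTP D)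
    (s : Finset ι) {c : ℝ} (hc : 0 ≤ c) (hs : ∀ x ∉ s, krausWeight (M x) ≤ c) :
    ∑ x, krausWeight (M x) * pureFidelity (krausState (M x)) (D (τ x)) ≤
      ∑ x ∈ s, krausWeight (M x) + c * Fintype.card b := by
  have hΦ := krausState_partialIsometry hM
  have hone : ∀ x, pureFidelity (krausState (M x)) (D (τ x)) ≤ 1 := fun x => by
    have hd := hD.map_isDensity (hτ x)
    have h := sum_pureFidelity_col_le_trace hΦ hd.1
    rw [hd.2, Complex.one_re] at h
    exact (Finset.single_le_sum
      (f := fun y => pureFidelity (krausState (M y)) (D (τ x)))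
      (fun y _ => pureFidelity_nonneg hd.1) (Finset.mem_univ x)).trans h
  -- From τ ≤ 1 follows D(τ) ≤ D(1), a bound independent of x; the trace of D(1) is the memory
  -- dimension.
  have hle : ∀ x, pureFidelity (krausState (M x)) (D (τ x)) ≤
      pureFidelity (krausState (M x)) (D 1) := fun x =>
    pureFidelity_mono (by rw [← map_sub]; exact hD.map_posSemidef (hτ x).one_sub_posSemidef)
  have hsum : ∑ x, pureFidelity (krausState (M x)) (D 1) ≤ Fintype.card b := by
    have h := sum_pureFidelity_col_le_trace hΦ (hD.map_posSemidef PosSemidef.one)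
    rw [hD.trace_preserving, trace_one, Complex.natCast_re] at h
    exact h
  have hnn : ∀ x, 0 ≤ pureFidelity (krausState (M x)) (D 1) := fun x =>
    pureFidelity_nonneg (hD.map_posSemidef PosSemidef.one)
  rw [← Finset.sum_add_sum_compl s]
  refine add_le_add (Finset.sum_le_sum fun x _ =>
    mul_le_of_le_one_right (krausWeight_nonneg _) (hone x)) ?_
  calc ∑ x ∈ sᶜ, krausWeight (M x) * pureFidelity (krausState (M x)) (D (τ x))
      ≤ ∑ x ∈ sᶜ, c * pureFidelity (krausState (M x)) (D 1) :=
        Finset.sum_le_sum fun x hx => mul_le_mul (hs x (Finset.mem_compl.1 hx)) (hle x)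
          (pureFidelity_nonneg (hD.map_isDensity (hτ x)).1) hc
    _ ≤ ∑ x, c * pureFidelity (krausState (M x)) (D 1) :=
        Finset.sum_le_univ_sum_of_nonneg fun x => mul_nonneg hc (hnn x)
    _ ≤ c * Fintype.card b := by
        rw [← Finset.mul_sum]
        exact mul_le_mul_of_nonneg_left hsum hc

/-- Below the entropy, even visible storage of the sequences of a diagonal Kraus representation
fails. -/
theorem IsDiagonalKraus.exists_storage_error [Nonempty d] (hE : IsCPTP E) {r : ℕ}
    {M : Fin r → Matrix d d ℂ} (hM : IsDiagonalKraus E M) {R : ℝ} (hR : R < mapEntropy E) :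
    ∃ ε : ℝ, 0 < ε ∧ ∀ᶠ n : ℕ in atTop, ∀ m : ℕ, (m : ℝ) ≤ n * R →
      ∀ τ : (Fin n → Fin r) → Matrix (Fin (2 ^ m)) (Fin (2 ^ m)) ℂ, (∀ x, IsDensity (τ x)) →
      ∀ D : Matrix (Fin (2 ^ m)) (Fin (2 ^ m)) ℂ →ₗ[ℂ]
          Matrix ((Fin n → d) × (Fin n → d)) ((Fin n → d) × (Fin n → d)) ℂ, IsCPTP D →
        ∑ x : Fin n → Fin r, krausWeight (tensorOp fun t => M (x t)) *
          pureFidelity (krausState (tensorOp fun t => M (x t))) (D (τ x)) ≤ 1 - ε := by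
  obtain ⟨δ, hδ, hS⟩ : ∃ δ : ℝ, 0 < δ ∧ mapEntropy E = R + 2 * δ :=
    ⟨(mapEntropy E - R) / 2, by linarith, by ring⟩
  -- The heavy sequences and the light ones each contribute at most 1/4. For the latter, 2^m ·
  -- 2^(-n(R+δ)) ≤ 2^(-nδ) ≤ 1/4 once nδ ≥ 2.
  refine ⟨1 / 2, by norm_num, ?_⟩
  have hlarge : ∀ᶠ n : ℕ in atTop, 2 ≤ n * δ :=
    (tendsto_natCast_atTop_atTop.atTop_mul_const hδ).eventually_ge_atTop 2
  filter_upwards [hlarge, eventually_sum_le_of_entropy_deviation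
    (fun i => krausWeight_nonneg (M i)) (hM.isKraus.sum_krausWeight hE) hM.mapEntropy_eq hδ
    (η := 1 / 4) (by norm_num)] with n hn hdev m hm τ hτ D hD
  have hc : (0 : ℝ) < 2 ^ (-(n * (R + δ)) : ℝ) := by positivity
  refine (sum_krausWeight_mul_pureFidelity_le (tensorOp_trace_orthogonal hM.trace_orthogonal) hτ hD
    (Finset.univ.filter fun x => (2 : ℝ) ^ (-(n * (R + δ)) : ℝ) <
      krausWeight (tensorOp fun t => M (x t))) hc.le (fun x hx => by simpa using hx)).trans ?_
  -- A heavy sequence has -log₂ p_x < n(R+δ) = nS - nδ, hence is atypical.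
  have h1 := hdev (Finset.univ.filter fun x => (2 : ℝ) ^ (-(n * (R + δ)) : ℝ) <
      krausWeight (tensorOp fun t => M (x t))) (fun x hx hpos => by
    have hx' := (Finset.mem_filter.1 hx).2
    rw [krausWeight_tensorOp, ← Real.lt_logb_iff_rpow_lt one_lt_two hpos] at hx'
    rw [hS]
    refine le_trans ?_ (neg_le_abs _)
    linarith)
  simp only [← krausWeight_tensorOp] at h1
  have h2 : (2 : ℝ) ^ (-(n * (R + δ)) : ℝ) * (Fintype.card (Fin (2 ^ m)) : ℝ) ≤ 1 / 4 := by
    rw [Fintype.card_fin, Nat.cast_pow, Nat.cast_ofNat, ← Real.rpow_natCast, ← Real.rpow_add two_pos]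
    calc (2 : ℝ) ^ (-(n * (R + δ)) + m : ℝ) ≤ 2 ^ (-2 : ℝ) :=
          Real.rpow_le_rpow_of_exponent_le one_le_two (by linarith)
      _ = 1 / 4 := by rw [Real.rpow_neg two_pos.le]; norm_num
  linarith

/-- The projection onto the span of at most `N` orthogonal states factors through an
`N`-dimensional space. -/
theorem exists_compression {ι b : Type*} [Fintype b] [DecidableEq b]
    {M : ι → Matrix d d ℂ} (hM : ∀ i j, i ≠ j → ((M i)ᴴ * M j).trace = 0) (T : Finset ι)
    (hT : ∀ x ∈ T, krausWeight (M x) ≠ 0) (hcard : T.card ≤ Fintype.card b) :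
    ∃ A : Matrix b (d × d) ℂ, A * Aᴴ * A = A ∧
      ∀ x ∈ T, pureFidelity (krausState (M x)) (Aᴴ * A) = 1 := by
  classical
  obtain ⟨e⟩ : Nonempty (T ↪ b) :=
    Function.Embedding.nonempty_of_card_le (by simpa using hcard)
  let Φ : Matrix (d × d) T ℂ := of fun p i => krausState (M i) p
  have hΦ : Φ * Φᴴ * Φ = Φ :=
    krausState_partialIsometry (M := fun i : T => M i) fun i j hij =>
      hM i j (Subtype.coe_injective.ne hij)
  -- `J` embeds the coordinates indexed by `T` isometrically into the memory; A = JΦ† reads out the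
  -- coefficients and A†A = ΦΦ†.
  let J : Matrix b T ℂ := of fun j x => if e x = j then 1 else 0
  have hJ : Jᴴ * J = 1 := by
    ext x y
    simp [J, mul_apply, one_apply, eq_comm]
  have hAA : (J * Φᴴ)ᴴ * (J * Φᴴ) = Φ * Φᴴ := by
    rw [conjTranspose_mul, conjTranspose_conjTranspose, Matrix.mul_assoc, ← Matrix.mul_assoc Jᴴ,
      hJ, Matrix.one_mul]
  refine ⟨J * Φᴴ, ?_, fun x hx => ?_⟩
  · rw [Matrix.mul_assoc, hAA, Matrix.mul_assoc]
    congr 1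
    simpa [Matrix.mul_assoc] using congrArg conjTranspose hΦ
  · have hcol : (Φ * Φᴴ) *ᵥ krausState (M x) = krausState (M x) := by
      ext p
      exact congrFun (congrFun hΦ p) ⟨x, hx⟩
    rw [hAA, pureFidelity, hcol, star_krausState_dotProduct_self (hT x hx), Complex.one_re]

/-- Schumacher compression: a partial isometry whose support captures the states of a diagonal
Kraus representation up to weight `ε / 2` gives an `ε`-faithful code. -/
theorem exists_isFaithful [Nonempty d] (hE : IsCPTP E) {n m r : ℕ}
    {M : Fin r → Matrix d d ℂ} (hM : IsDiagonalKraus E M)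
    {A : Matrix (Fin (2 ^ m)) ((Fin n → d) × (Fin n → d)) ℂ} (hA : A * Aᴴ * A = A)
    {T : Finset (Fin n → Fin r)} {ε : ℝ}
    (hT : ∀ x ∈ T, pureFidelity (krausState (tensorOp fun t => M (x t))) (Aᴴ * A) = 1)
    (hε : 1 - ε / 2 ≤ ∑ x ∈ T, krausWeight (tensorOp fun t => M (x t))) :
    ∃ C : StorageCode d n m, C.IsFaithful E ε := by
  have hA' : Aᴴ * Aᴴᴴ * Aᴴ = Aᴴ := by
    simpa [Matrix.mul_assoc] using congrArg conjTranspose hA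
  let o : Fin (2 ^ m) := ⟨0, by positivity⟩
  let o' : (Fin n → d) × (Fin n → d) := Classical.arbitrary _
  refine ⟨⟨compressionMap A o, compressionMap Aᴴ o', isCPTP_compressionMap hA o,
    isCPTP_compressionMap hA' o'⟩, fun r' N hN => ?_⟩
  have hpsd := posSemidef_conjTranspose_mul_self A
  -- The right-hand side mentions only `E`: this transfers the estimate from the diagonal
  -- representation to arbitrary ones.
  have hsum : ∀ {r : ℕ} {N : Fin n → Fin r → Matrix d d ℂ}, (∀ t, IsKraus E (N t)) →
      ∑ x : Fin n → Fin r, krausWeight (tensorOp fun t => N t (x t)) *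
        pureFidelity (krausState (tensorOp fun t => N t (x t))) (Aᴴ * A) =
      (Aᴴ * A * of fun p q : (Fin n → d) × (Fin n → d) =>
        (∏ t, E (single (p.2 t) (q.2 t) 1) (p.1 t) (q.1 t)) *
          (Fintype.card (Fin n → d) : ℂ)⁻¹).trace.re := by
    intro r N hN
    simp only [krausWeight_mul_pureFidelity_krausState]
    simp only [pureFidelity_eq_trace]
    rw [← Complex.re_sum, ← trace_sum, ← Finset.mul_sum, sum_vecMulVec_krausVec_tensorOp hN]
  have htyp : 1 - ε / 2 ≤ ∑ x : Fin n → Fin r', krausWeight (tensorOp fun t => N t (x t)) *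
      pureFidelity (krausState (tensorOp fun t => N t (x t))) (Aᴴ * A) := by
    rw [hsum hN, ← hsum (N := fun _ => M) fun _ => hM.isKraus]
    refine hε.trans ?_
    calc ∑ x ∈ T, krausWeight (tensorOp fun t => M (x t))
        = ∑ x ∈ T, krausWeight (tensorOp fun t => M (x t)) *
            pureFidelity (krausState (tensorOp fun t => M (x t))) (Aᴴ * A) :=
          Finset.sum_congr rfl fun x hx => by rw [hT x hx, mul_one]
      _ ≤ _ := Finset.sum_le_univ_sum_of_nonneg fun x =>
          mul_nonneg (krausWeight_nonneg _) (pureFidelity_nonneg hpsd)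
  have hone := sum_krausWeight_tensorOp hE hN
  -- The fidelity is at least a² with a = ⟨ψ|A†A|ψ⟩, and a² ≥ 2a - 1 makes the bound linear in a;
  -- this is why a loss of ε/2 is allowed.
  calc 1 - ε ≤ 2 * (∑ x : Fin n → Fin r', krausWeight (tensorOp fun t => N t (x t)) *
        pureFidelity (krausState (tensorOp fun t => N t (x t))) (Aᴴ * A)) -
        ∑ x : Fin n → Fin r', krausWeight (tensorOp fun t => N t (x t)) := by
        rw [hone]; linarith
    _ = ∑ x : Fin n → Fin r', krausWeight (tensorOp fun t => N t (x t)) *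
        (2 * pureFidelity (krausState (tensorOp fun t => N t (x t))) (Aᴴ * A) - 1) := by
        rw [Finset.mul_sum, ← Finset.sum_sub_distrib]
        exact Finset.sum_congr rfl fun x _ => by ring
    _ ≤ _ := by
        refine Finset.sum_le_sum fun x _ => mul_le_mul_of_nonneg_left ?_ (krausWeight_nonneg _)
        refine le_trans ?_ (le_pureFidelity_compressionMap hA o o' _)
        linarith [two_mul_le_add_sq
          (pureFidelity (krausState (tensorOp fun t => N t (x t))) (Aᴴ * A)) 1]

theorem isAchievableRate_of_mapEntropy_lt [Nonempty d] (hE : IsCPTP E) {R : ℝ}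
    (hR : mapEntropy E < R) : IsAchievableRate E R := by
  intro ε hε
  obtain ⟨r, M, hM⟩ := exists_isDiagonalKraus hE
  have hS0 := mapEntropy_nonneg hE
  obtain ⟨δ, hδ, hS⟩ : ∃ δ : ℝ, 0 < δ ∧ R = mapEntropy E + 2 * δ :=
    ⟨(R - mapEntropy E) / 2, by linarith, by ring⟩
  have hlarge : ∀ᶠ n : ℕ in atTop, 1 ≤ n * δ :=
    (tendsto_natCast_atTop_atTop.atTop_mul_const hδ).eventually_ge_atTop 1
  filter_upwards [hlarge, eventually_sum_le_of_entropy_deviation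
    (fun i => krausWeight_nonneg (M i)) (hM.isKraus.sum_krausWeight hE) hM.mapEntropy_eq hδ
    (η := ε / 2) (by linarith)] with n hn hdev
  have hnR : 0 ≤ n * R := mul_nonneg (Nat.cast_nonneg _) (by linarith)
  set S := mapEntropy E with hSdef
  have hc : (0 : ℝ) < 2 ^ (-(n * (S + δ)) : ℝ) := by positivity
  let T : Finset (Fin n → Fin r) := Finset.univ.filter fun x =>
    (2 : ℝ) ^ (-(n * (S + δ)) : ℝ) ≤ krausWeight (tensorOp fun t => M (x t))
  have hone := sum_krausWeight_tensorOp hE (n := n) (M := fun _ => M) fun _ => hM.isKraus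
  have hcard : T.card ≤ Fintype.card (Fin (2 ^ ⌊n * R⌋₊)) := by
    have h1 : (T.card : ℝ) * 2 ^ (-(n * (S + δ)) : ℝ) ≤ 1 := by
      rw [← nsmul_eq_mul, ← hone]
      exact (Finset.card_nsmul_le_sum T _ _ fun x hx => (Finset.mem_filter.1 hx).2).trans
        (Finset.sum_le_univ_sum_of_nonneg fun x => krausWeight_nonneg _)
    have h2 : (T.card : ℝ) ≤ 2 ^ (n * (S + δ) : ℝ) := by
      rwa [Real.rpow_neg two_pos.le, ← div_eq_mul_inv, div_le_one (by positivity)] at h1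
    -- Rounding nR = n(S+2δ) down loses less than one qubit, which the spare nδ ≥ 1 covers.
    have h3 : (2 : ℝ) ^ (n * (S + δ) : ℝ) ≤ 2 ^ (⌊n * R⌋₊ : ℝ) := by
      refine Real.rpow_le_rpow_of_exponent_le one_le_two ?_
      have := Nat.lt_floor_add_one (n * R)
      rw [hS] at this ⊢
      linarith
    rw [Real.rpow_natCast] at h3
    rw [Fintype.card_fin]
    exact_mod_cast h2.trans h3
  have hT0 : ∀ x ∈ T, krausWeight (tensorOp fun t => M (x t)) ≠ 0 := fun x hx =>
    (hc.trans_le (Finset.mem_filter.1 hx).2).ne'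
  obtain ⟨A, hA, hAT⟩ := exists_compression (b := Fin (2 ^ ⌊n * R⌋₊))
    (tensorOp_trace_orthogonal hM.trace_orthogonal) T hT0 hcard
  refine ⟨⌊n * R⌋₊, Nat.floor_le hnR, exists_isFaithful hE hM hA hAT ?_⟩
  have h1 := hdev Tᶜ (fun x hx hpos => by
    have hx' : krausWeight (tensorOp fun t => M (x t)) < (2 : ℝ) ^ (-(n * (S + δ)) : ℝ) := by
      simpa [T] using hx
    rw [krausWeight_tensorOp, ← Real.logb_lt_iff_lt_rpow one_lt_two hpos] at hx'
    refine le_trans ?_ (le_abs_self _)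
    linarith)
  simp only [← krausWeight_tensorOp] at h1
  rw [← Finset.sum_add_sum_compl T] at hone
  linarith

theorem mapEntropy_le_of_isAchievableRate [Nonempty d] (hE : IsCPTP E) {R : ℝ}
    (hR : IsAchievableRate E R) : mapEntropy E ≤ R := by
  by_contra! hlt
  obtain ⟨r, M, hM⟩ := exists_isDiagonalKraus hE
  obtain ⟨ε, hε, hconv⟩ := hM.exists_storage_error hE hlt
  obtain ⟨n, hn, m, hm, C, hC⟩ := (hconv.and (hR (ε / 2) (by linarith))).exists
  let ρ : (Fin n → Fin r) → Matrix ((Fin n → d) × (Fin n → d)) ((Fin n → d) × (Fin n → d)) ℂ :=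
    fun x => vecMulVec (krausState (tensorOp fun t => M (x t)))
      (star (krausState (tensorOp fun t => M (x t))))
  -- At weight zero `krausState` is the zero vector and gives no density matrix. The encoding of a
  -- sequence of nonzero weight stands in, without changing the average.
  obtain ⟨x₀, hx₀⟩ : ∃ x₀ : Fin n → Fin r, krausWeight (tensorOp fun t => M (x₀ t)) ≠ 0 := by
    by_contra! h
    have := sum_krausWeight_tensorOp hE (n := n) (M := fun _ => M) fun _ => hM.isKraus
    simp [h] at this
  let τ : (Fin n → Fin r) → Matrix (Fin (2 ^ m)) (Fin (2 ^ m)) ℂ := fun x =>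
    if krausWeight (tensorOp fun t => M (x t)) = 0 then C.encode (ρ x₀) else C.encode (ρ x)
  have hτ : ∀ x, IsDensity (τ x) := by
    intro x
    by_cases hx : krausWeight (tensorOp fun t => M (x t)) = 0
    · simp only [τ, hx, if_true]
      exact C.encode_cptp.map_isDensity (isDensity_vecMulVec_krausState hx₀)
    · simp only [τ, hx, if_false]
      exact C.encode_cptp.map_isDensity (isDensity_vecMulVec_krausState hx)
  have h1 := hn m hm τ hτ C.decode C.decode_cptp
  have h2 : 1 - ε / 2 ≤ C.averageFidelity fun _ => M := hC r (fun _ => M) fun _ => hM.isKraus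
  have h3 : (C.averageFidelity fun _ => M) =
      ∑ x : Fin n → Fin r, krausWeight (tensorOp fun t => M (x t)) *
        pureFidelity (krausState (tensorOp fun t => M (x t))) (C.decode (τ x)) := by
    refine Finset.sum_congr rfl fun x _ => ?_
    by_cases hx : krausWeight (tensorOp fun t => M (x t)) = 0
    · simp only [hx, zero_mul]
    · simp only [τ, hx, if_false, ρ]
  linarith

end Storage

theorem mainTheorem2 {d : Type*} [Fintype d] [DecidableEq d] [Nonempty d]
    (E : Matrix d d ℂ →ₗ[ℂ] Matrix d d ℂ) (hE : IsCPTP E) :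
    -- a diagonal Kraus representation exists
    (∃ (r : ℕ) (M : Fin r → Matrix d d ℂ), IsDiagonalKraus E M) ∧
    -- its weights form a probability distribution, which is the spectrum of the Choi state (up to
    -- zeros, with multiplicity), with eigenvectors `ψ_μ`; so its entropy depends on `E` only
    (∀ (r : ℕ) (M : Fin r → Matrix d d ℂ), IsDiagonalKraus E M →
      ∑ μ, krausWeight (M μ) = 1 ∧
      (∀ μ ν, μ ≠ ν → star (krausState (M μ)) ⬝ᵥ krausState (M ν) = 0) ∧
      choiState E = ∑ μ, (krausWeight (M μ) : ℂ) •
        vecMulVec (krausState (M μ)) (star (krausState (M μ))) ∧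
      (choiState E).charpoly.roots.filter (· ≠ 0) =
        (Finset.univ.val.map fun μ => (krausWeight (M μ) : ℂ)).filter (· ≠ 0) ∧
      mapEntropy E = -∑ μ, krausWeight (M μ) * Real.logb 2 (krausWeight (M μ))) ∧
    -- the entropy is the optimal rate, in qubits per use, of faithful storage
    IsGLB {R : ℝ | IsAchievableRate E R} (mapEntropy E) ∧
    -- below the entropy, storage fails already for the sequences of a diagonal Kraus
    -- representation, for all large `n` and even if the encoder is told the sequence `x` and may
    -- store it in an arbitrary state `τ x`
    (∀ (r : ℕ) (M : Fin r → Matrix d d ℂ), IsDiagonalKraus E M → ∀ R : ℝ, R < mapEntropy E →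
      ∃ ε : ℝ, 0 < ε ∧ ∀ᶠ n : ℕ in atTop, ∀ m : ℕ, (m : ℝ) ≤ n * R →
        ∀ τ : (Fin n → Fin r) → Matrix (Fin (2 ^ m)) (Fin (2 ^ m)) ℂ, (∀ x, IsDensity (τ x)) →
        ∀ D : Matrix (Fin (2 ^ m)) (Fin (2 ^ m)) ℂ →ₗ[ℂ]
            Matrix ((Fin n → d) × (Fin n → d)) ((Fin n → d) × (Fin n → d)) ℂ, IsCPTP D →
          ∑ x : Fin n → Fin r, krausWeight (tensorOp fun t => M (x t)) *
            pureFidelity (krausState (tensorOp fun t => M (x t))) (D (τ x)) ≤ 1 - ε) := by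
  refine ⟨exists_isDiagonalKraus hE, fun r M hM => ⟨hM.isKraus.sum_krausWeight hE, ?_, ?_,
    hM.filter_roots_charpoly, hM.mapEntropy_eq⟩, ⟨fun R hR => ?_, fun b hb => ?_⟩,
    fun r M hM R hR => hM.exists_storage_error hE hR⟩
  · intro μ ν hμν
    rw [star_krausState_dotProduct, star_krausVec_dotProduct, hM.trace_orthogonal μ ν hμν,
      zero_mul, mul_zero]
  · simp only [krausWeight_smul_vecMulVec_krausState]
    exact hM.isKraus.choiState_eq
  · exact mapEntropy_le_of_isAchievableRate hE hR
  -- The entropy itself need not be achievable; every larger rate is, which suffices for the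
  -- infimum.
  · exact le_of_forall_gt_imp_ge_of_dense fun R hR => hb (isAchievableRate_of_mapEntropy_lt hE hR)
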